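/- Let $(M,g)$ and $(N,h)$ be two (smooth, finite-dimensional) Riemannian manifolds, $V$ a smooth vector field on $M$, $(P,J,p)$ a Kähler manifold, and $\psi\colon M\to N$ and $\varphi\colon N\to P$ two smooth maps. For a smooth map $\phi$ from $(M,g)$ to a Riemannian manifold let $\tau(\phi)=\operatorname{trace}_g\nabla d\phi$ be its tension field and $\tau_V(\phi)=\tau(\phi)+d\phi(V)$ its $V$-tension field; $\phi$ is called $V$-harmonic if $\tau_V(\phi)=0$, and harmonic if $\tau(\phi)=0$ (real- or complex-valued functions are viewed as maps into $\mathbb R$ or $\mathbb C$ with the flat metric). Suppose that - $\psi$ is a $V$-harmonic morphism, i.e. for every open $U\subset N$ and every harmonic function $f\colon U\to\mathbb R$ the function $f\circ\psi\colon\psi^{-1}(U)\to\mathbb R$ is $V$-harmonic; and - $\varphi$ is a pseudo harmonic morphism, i.e. for every open $W\subset P$ and every holomorphic function $f\colon W\to\mathbb C$ the map $f\circ\varphi\colon\varphi^{-1}(W)\to\mathbb C$ is harmonic. Then $\Phi=\varphi\circ\psi\colon M\to P$ is a $V$-pseudo harmonic morphism, i.e. $\Phi$ is $V$-harmonic, $\tau_V(\Phi)=0$,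 and pseudo-horizontally weakly conformal, $[d\Phi_x\circ d\Phi_x^*,J]=0$ for every $x\in M$, where $d\Phi_x^*\colon T_{\Phi(x)}P\to T_xM$ is the adjoint of $d\Phi_x$. -/

import Mathlib

open scoped Manifold ContDiff Topology
open Bundle

namespace VHarm

/-!
Conventions. Real manifolds are modelled on a finite-dimensional real normed space `E` (so they
have no boundary), with model `𝓘(ℝ, E)`. The tangent space at `x` is Mathlib's
`TangentSpace 𝓘(ℝ, E) x`, a copy of `E` through the preferred chart `extChartAt 𝓘(ℝ, E) x`.
Tensorial quantities at `x` are computed by the classical coordinate formulas in that chart.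
-/

section Riemannian

variable {E : Type*} [NormedAddCommGroup E] [NormedSpace ℝ E]
  {M : Type*} [TopologicalSpace M] [ChartedSpace E M]

/-- The coordinate expression, in the chart `c` around `x`, of a field `β` of bilinear forms on the
tangent spaces: at `y` it is the pull-back of `β` by `c⁻¹`,
`(v, w) ↦ β_{c⁻¹ y} (d(c⁻¹)_y v, d(c⁻¹)_y w)`. For a metric, this is the matrix `(g_ij)` at `y`. -/
noncomputable def coordForm
    (β : ∀ p : M, TangentSpace 𝓘(ℝ, E) p →L[ℝ] TangentSpace 𝓘(ℝ, E) p →L[ℝ] ℝ)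
    (x : M) (v w : E) (y : E) : ℝ :=
  β ((extChartAt 𝓘(ℝ, E) x).symm y)
    (mfderiv 𝓘(ℝ, E) 𝓘(ℝ, E) (extChartAt 𝓘(ℝ, E) x).symm y v)
    (mfderiv 𝓘(ℝ, E) 𝓘(ℝ, E) (extChartAt 𝓘(ℝ, E) x).symm y w)

/-- The derivative at (the image of) `x`, in the direction `u`, of the coordinate expression of
`β` in the chart around `x`, evaluated on `v, w`: in coordinates `u^k v^i w^j ∂_k β_ij`. -/
noncomputable def coordFormDeriv
    (β : ∀ p : M, TangentSpace 𝓘(ℝ, E) p →L[ℝ] TangentSpace 𝓘(ℝ, E) p →L[ℝ] ℝ) (x : M)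
    (u v w : TangentSpace 𝓘(ℝ, E) x) : ℝ :=
  fderiv ℝ (coordForm β x v w) (extChartAt 𝓘(ℝ, E) x x) u

variable [IsManifold 𝓘(ℝ, E) ∞ M]

variable (E M) in
/-- Smooth Riemannian metrics on the manifold `M`. -/
abbrev Metric : Type _ :=
  ContMDiffRiemannianMetric 𝓘(ℝ, E) ∞ E (fun x : M ↦ TangentSpace 𝓘(ℝ, E) x)

/-- The inner product `g_x` on `T_x M` as a bilinear form. -/
noncomputable def metricForm (g : Metric E M) (x : M) :
    LinearMap.BilinForm ℝ (TangentSpace 𝓘(ℝ, E) x) :=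
  LinearMap.mk₂ ℝ (fun u v ↦ g.inner x u v) (by simp) (by simp) (by simp) (by simp)

theorem metricForm_nondegenerate (g : Metric E M) (x : M) : (metricForm g x).Nondegenerate := by
  have key : ∀ u : TangentSpace 𝓘(ℝ, E) x, metricForm g x u u = 0 → u = 0 := fun u hu ↦ by
    by_contra h
    exact (g.pos x u h).ne' hu
  exact ⟨fun u hu ↦ key u (hu u), fun u hu ↦ key u (hu u)⟩

/-- Smooth vector fields on `M`. -/
def IsSmoothVectorField (V : ∀ x : M, TangentSpace 𝓘(ℝ, E) x) : Prop :=
  ContMDiff 𝓘(ℝ, E) 𝓘(ℝ, E).tangent ∞ (fun x ↦ (⟨x, V x⟩ : TangentBundle 𝓘(ℝ, E) M))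

variable [FiniteDimensional ℝ E]

/-- The standard basis of `T_x M ≅ E`, that is, the coordinate frame `∂_i`. -/
noncomputable def frame (x : M) :
    Module.Basis (Fin (Module.finrank ℝ E)) ℝ (TangentSpace 𝓘(ℝ, E) x) :=
  (Module.finBasis ℝ E : Module.Basis (Fin (Module.finrank ℝ E)) ℝ E)

instance (x : M) : FiniteDimensional ℝ (TangentSpace 𝓘(ℝ, E) x) :=
  inferInstanceAs (FiniteDimensional ℝ E)

/-- The `g`-dual frame `∂^i = ∑_j g^{ij} ∂_j`, characterized by `g (∂^i, ∂_j) = δ_ij`. -/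
noncomputable def dualFrame (g : Metric E M) (x : M) :
    Module.Basis (Fin (Module.finrank ℝ E)) ℝ (TangentSpace 𝓘(ℝ, E) x) :=
  (metricForm g x).dualBasis (metricForm_nondegenerate g x) (frame x)

/-- The vector `α^♯` that represents a linear form `α` on `T_x M`: `g_x (α^♯, v) = α v`. -/
noncomputable def sharp (g : Metric E M) (x : M)
    (α : Module.Dual ℝ (TangentSpace 𝓘(ℝ, E) x)) : TangentSpace 𝓘(ℝ, E) x :=
  ((metricForm g x).toDual (metricForm_nondegenerate g x)).symm α

/-- The metric trace `∑_{i,j} g^{ij} B (∂_i, ∂_j) = ∑_i B (∂_i, ∂^i)` of a bilinear map `B` on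
`T_x M`. -/
noncomputable def trace (g : Metric E M) (x : M) {X : Type*} [AddCommMonoid X]
    (B : TangentSpace 𝓘(ℝ, E) x → TangentSpace 𝓘(ℝ, E) x → X) : X :=
  ∑ i, B (frame x i) (dualFrame g x i)

/-- The Christoffel symbol `Γ (u, v) = ∑ u^i v^j Γ_ij^k ∂_k` at `x` of the Levi-Civita connection
of `g`, in the chart around `x`:
`Γ (u, v) = ∑_l ½ u^i v^j (∂_i g_jl + ∂_j g_il - ∂_l g_ij) ∂^l`. -/
noncomputable def christoffel (g : Metric E M) (x : M) (u v : TangentSpace 𝓘(ℝ, E) x) :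
    TangentSpace 𝓘(ℝ, E) x :=
  ∑ l, ((1 / 2 : ℝ) * (coordFormDeriv g.inner x u v (frame x l)
    + coordFormDeriv g.inner x v u (frame x l)
    - coordFormDeriv g.inner x (frame x l) u v)) • dualFrame g x l

end Riemannian

section Maps

variable {E : Type*} [NormedAddCommGroup E] [NormedSpace ℝ E] [FiniteDimensional ℝ E]
  {M : Type*} [TopologicalSpace M] [ChartedSpace E M] [IsManifold 𝓘(ℝ, E) ∞ M]
  {E' : Type*} [NormedAddCommGroup E'] [NormedSpace ℝ E'] [FiniteDimensional ℝ E']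
  {N : Type*} [TopologicalSpace N] [ChartedSpace E' N] [IsManifold 𝓘(ℝ, E') ∞ N]

/-- The second fundamental form `∇dφ` at `x`. In the charts around `x` and `φ x`,
`∇dφ (u, v) = D²φ (u, v) - Dφ (Γ^M (u, v)) + Γ^N (Dφ u, Dφ v)`. -/
noncomputable def secondFundamentalForm (g : Metric E M) (h : Metric E' N) (φ : M → N) (x : M)
    (u v : TangentSpace 𝓘(ℝ, E) x) : TangentSpace 𝓘(ℝ, E') (φ x) :=
  let D2 : E →L[ℝ] E →L[ℝ] E' :=
    fderiv ℝ (fderiv ℝ (writtenInExtChartAt 𝓘(ℝ, E) 𝓘(ℝ, E') x φ)) (extChartAt 𝓘(ℝ, E) x x)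
  let S : TangentSpace 𝓘(ℝ, E') (φ x) := D2 u v
  S - mfderiv 𝓘(ℝ, E) 𝓘(ℝ, E') φ x (christoffel g x u v)
    + christoffel h (φ x) (mfderiv 𝓘(ℝ, E) 𝓘(ℝ, E') φ x u) (mfderiv 𝓘(ℝ, E) 𝓘(ℝ, E') φ x v)

/-- The tension field `τ(φ) = trace ∇dφ`. -/
noncomputable def tension (g : Metric E M) (h : Metric E' N) (φ : M → N) (x : M) :
    TangentSpace 𝓘(ℝ, E') (φ x) :=
  trace g x (secondFundamentalForm g h φ x)

/-- The `V`-tension field `τ_V(φ) = τ(φ) + dφ(V)`. -/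
noncomputable def vTension (g : Metric E M) (h : Metric E' N) (V : ∀ x : M, TangentSpace 𝓘(ℝ, E) x)
    (φ : M → N) (x : M) : TangentSpace 𝓘(ℝ, E') (φ x) :=
  tension g h φ x + mfderiv 𝓘(ℝ, E) 𝓘(ℝ, E') φ x (V x)

/-- `φ` is a (smooth) `V`-harmonic map on the open set `U`: `τ_V(φ) = 0` there. Only the values of
`φ` on `U` matter. -/
def IsVHarmonicOn (g : Metric E M) (h : Metric E' N) (V : ∀ x : M, TangentSpace 𝓘(ℝ, E) x)
    (φ : M → N) (U : Set M) : Prop :=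
  ContMDiffOn 𝓘(ℝ, E) 𝓘(ℝ, E') ∞ φ U ∧ ∀ x ∈ U, vTension g h V φ x = 0

/-- `φ : M → N` is a (smooth) `V`-harmonic map. -/
def IsVHarmonic (g : Metric E M) (h : Metric E' N) (V : ∀ x : M, TangentSpace 𝓘(ℝ, E) x)
    (φ : M → N) : Prop :=
  ContMDiff 𝓘(ℝ, E) 𝓘(ℝ, E') ∞ φ ∧ ∀ x, vTension g h V φ x = 0

/-- `φ` is a (smooth) harmonic map on the open set `U`: `τ(φ) = 0` there. -/
def IsHarmonicOn (g : Metric E M) (h : Metric E' N) (φ : M → N) (U : Set M) : Prop :=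
  ContMDiffOn 𝓘(ℝ, E) 𝓘(ℝ, E') ∞ φ U ∧ ∀ x ∈ U, tension g h φ x = 0

/-- The flat metric of a Euclidean space, used for `ℝ` and `ℂ`; local (`V`-)harmonic functions are
local (`V`-)harmonic maps to `ℝ` or `ℂ` with this metric. -/
noncomputable def flatMetric (X : Type*) [NormedAddCommGroup X] [InnerProductSpace ℝ X] :
    Metric X X where
  inner := (riemannianMetricVectorSpace X).inner
  symm := (riemannianMetricVectorSpace X).symm
  pos := (riemannianMetricVectorSpace X).pos
  isVonNBounded := (riemannianMetricVectorSpace X).isVonNBounded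
  contMDiff := (riemannianMetricVectorSpace X).contMDiff.of_le le_top

/-- `ψ : M → N` is a `V`-harmonic morphism: it is smooth, and it pulls back local harmonic
functions on `N` to local `V`-harmonic functions on `M`. -/
def IsVHarmonicMorphism (g : Metric E M) (h : Metric E' N)
    (V : ∀ x : M, TangentSpace 𝓘(ℝ, E) x) (ψ : M → N) : Prop :=
  ContMDiff 𝓘(ℝ, E) 𝓘(ℝ, E') ∞ ψ ∧
    ∀ (U : Set N) (f : N → ℝ), IsOpen U → IsHarmonicOn h (flatMetric ℝ) f U →
      IsVHarmonicOn g (flatMetric ℝ) V (f ∘ ψ) (ψ ⁻¹' U)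

/-- The adjoint `dφ_x^* : T_{φ x} N → T_x M`, characterized by
`g_x (dφ_x^* w, v) = h_{φ x} (w, dφ_x v)`. -/
noncomputable def diffAdjoint (g : Metric E M) (h : Metric E' N) (φ : M → N) (x : M)
    (w : TangentSpace 𝓘(ℝ, E') (φ x)) : TangentSpace 𝓘(ℝ, E) x :=
  sharp g x (((h.inner (φ x) w).comp (mfderiv 𝓘(ℝ, E) 𝓘(ℝ, E') φ x)).toLinearMap)

end Maps

section Complex

variable {F : Type*} [NormedAddCommGroup F] [NormedSpace ℂ F]
  {P : Type*} [TopologicalSpace P] [ChartedSpace F P]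

/-- A complex manifold modelled on `F` is a smooth real manifold with the same charts. -/
instance isManifold_real_of_complex [IsManifold 𝓘(ℂ, F) ω P] : IsManifold 𝓘(ℝ, F) ∞ P := by
  refine isManifold_of_contDiffOn _ _ _ fun e e' he he' ↦ ?_
  have h := (contDiffGroupoid ω 𝓘(ℂ, F)).compatible he he'
  rw [contDiffGroupoid, mem_groupoid_of_pregroupoid] at h
  have h1 : ContDiffOn ℂ ω (e.symm ≫ₕ e') ((e.symm ≫ₕ e').source) := by
    simpa [contDiffPregroupoid] using h.1
  simpa using (h1.restrict_scalars ℝ).of_le le_top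

/-- The complex structure `J` of a complex manifold: multiplication by `i` in the holomorphic
chart around `p`. -/
noncomputable def J (p : P) : TangentSpace 𝓘(ℝ, F) p →L[ℝ] TangentSpace 𝓘(ℝ, F) p :=
  (Complex.I • ContinuousLinearMap.id ℝ F : F →L[ℝ] F)

variable [IsManifold 𝓘(ℂ, F) ω P]

/-- The fundamental 2-form `ω (v, w) = g (J v, w)`. -/
noncomputable def fundamentalForm (k : Metric F P) (p : P) :
    TangentSpace 𝓘(ℝ, F) p →L[ℝ] TangentSpace 𝓘(ℝ, F) p →L[ℝ] ℝ :=
  (k.inner p).comp (J p)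

/-- A Riemannian metric on a complex manifold is Kähler if it is Hermitian and its fundamental
form is closed. -/
structure IsKahler (k : Metric F P) : Prop where
  hermitian : ∀ (p : P) (v w : TangentSpace 𝓘(ℝ, F) p), k.inner p (J p v) (J p w) = k.inner p v w
  closed : ∀ (p : P) (u v w : TangentSpace 𝓘(ℝ, F) p),
    coordFormDeriv (fundamentalForm k) p u v w + coordFormDeriv (fundamentalForm k) p v w u
      + coordFormDeriv (fundamentalForm k) p w u v = 0

variable [FiniteDimensional ℂ F]
  {E : Type*} [NormedAddCommGroup E] [NormedSpace ℝ E] [FiniteDimensional ℝ E]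
  {M : Type*} [TopologicalSpace M] [ChartedSpace E M] [IsManifold 𝓘(ℝ, E) ∞ M]

variable (F) in
/-- `φ : M → P` is a pseudo harmonic morphism: it is smooth, and it pulls back local holomorphic
functions on `P` to local harmonic maps from `M` to `ℂ`. -/
def IsPseudoHarmonicMorphism (g : Metric E M) (φ : M → P) : Prop :=
  ContMDiff 𝓘(ℝ, E) 𝓘(ℝ, F) ∞ φ ∧
    ∀ (W : Set P) (f : P → ℂ), IsOpen W → MDifferentiableOn 𝓘(ℂ, F) 𝓘(ℂ) f W →
      IsHarmonicOn g (flatMetric ℂ) (f ∘ φ) (φ ⁻¹' W)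

/-- `φ : M → P` is pseudo-horizontally weakly conformal: `[dφ_x ∘ dφ_x^*, J] = 0` at every `x`. -/
def IsPHWC (g : Metric E M) (k : Metric F P) (φ : M → P) : Prop :=
  ∀ (x : M) (w : TangentSpace 𝓘(ℝ, F) (φ x)),
    mfderiv 𝓘(ℝ, E) 𝓘(ℝ, F) φ x (diffAdjoint g k φ x (J (φ x) w)) =
      J (φ x) (mfderiv 𝓘(ℝ, E) 𝓘(ℝ, F) φ x (diffAdjoint g k φ x w))

/-- `φ : M → P` is a `V`-pseudo harmonic morphism: it is `V`-harmonic and pseudo-horizontally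
weakly conformal. -/
def IsVPseudoHarmonicMorphism (g : Metric E M) (k : Metric F P)
    (V : ∀ x : M, TangentSpace 𝓘(ℝ, E) x) (φ : M → P) : Prop :=
  IsVHarmonic g k V φ ∧ IsPHWC g k φ

end Complex

end VHarm

namespace VHarm

section LinearAlgebra

variable {F : Type*} [NormedAddCommGroup F] [NormedSpace ℂ F]

theorem eq_zero_of_forall_clm {z : F} (hz : ∀ m : F →L[ℂ] ℂ, m z = 0) : z = 0 := by
  by_contra h
  obtain ⟨m, -, hm⟩ := exists_dual_vector ℂ z (norm_ne_zero_iff.2 h)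
  rw [hz m] at hm
  exact h (by simpa using hm.symm)

theorem sum_smul_eq_zero {ι : Type*} [Fintype ι] {a b : ι → F}
    (H : ∀ ℓ m : F →L[ℂ] ℂ, ∑ i, ℓ (a i) * m (b i) = 0) (ℓ : F →L[ℂ] ℂ) :
    ∑ i, ℓ (a i) • b i = 0 :=
  eq_zero_of_forall_clm fun m ↦ by simpa using H ℓ m

theorem sum_bilinear_eq_zero [FiniteDimensional ℂ F] {ι : Type*} [Fintype ι] {a b : ι → F}
    (H : ∀ ℓ m : F →L[ℂ] ℂ, ∑ i, ℓ (a i) * m (b i) = 0) (G : F →ₗ[ℂ] F →ₗ[ℂ] F) :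
    ∑ i, G (a i) (b i) = 0 := by
  let e := Module.finBasis ℂ F
  have h : ∀ i, G (a i) (b i) = ∑ j, e.repr (a i) j • G (e j) (b i) := fun i ↦ by
    conv_lhs => rw [← e.sum_repr (a i)]
    simp only [map_sum, map_smul, LinearMap.sum_apply, LinearMap.smul_apply]
  simp_rw [h]
  rw [Finset.sum_comm]
  refine Finset.sum_eq_zero fun j _ ↦ ?_
  have := sum_smul_eq_zero H (LinearMap.toContinuousLinearMap (e.coord j))
  simp only [LinearMap.coe_toContinuousLinearMap', Module.Basis.coord_apply] at this
  simp_rw [← map_smul, ← map_sum]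
  rw [this, map_zero]

theorem sum_smul_I_eq {ι : Type*} [Fintype ι] {a b : ι → F}
    (H : ∀ ℓ m : F →L[ℂ] ℂ, ∑ i, ℓ (a i) * m (b i) = 0) {α β : F →L[ℝ] ℝ}
    (hαβ : ∀ z, β z = -α (Complex.I • z)) :
    ∑ i, β (a i) • b i = Complex.I • ∑ i, α (a i) • b i := by
  have h := sum_smul_eq_zero H (StrongDual.extendRCLike α)
  have h' : ∀ i, StrongDual.extendRCLike (𝕜 := ℂ) α (a i) • b i =
      α (a i) • b i + Complex.I • β (a i) • b i := fun i ↦ by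
    rw [StrongDual.extendRCLike_apply, hαβ, ← Complex.coe_smul (α (a i)),
      ← Complex.coe_smul (-α _), smul_smul, ← add_smul]
    simp [sub_eq_add_neg]
  simp_rw [h', Finset.sum_add_distrib, ← Finset.smul_sum] at h
  have h2 := congrArg (Complex.I • ·) h
  simp only [smul_add, smul_smul, Complex.I_mul_I, neg_one_smul, smul_zero] at h2
  exact (add_neg_eq_zero.1 h2).symm

end LinearAlgebra

section Calculus

variable {E : Type*} [NormedAddCommGroup E] [NormedSpace ℝ E]
  {X Y : Type*} [NormedAddCommGroup X] [NormedSpace ℝ X] [NormedAddCommGroup Y] [NormedSpace ℝ Y]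

theorem fderiv_fderiv_clm_comp {u : E → X} {y : E} (hu : ContDiffAt ℝ 2 u y) (L : X →L[ℝ] Y)
    (v w : E) : fderiv ℝ (fderiv ℝ (L ∘ u)) y v w = L (fderiv ℝ (fderiv ℝ u) y v w) := by
  have h1 : fderiv ℝ (L ∘ u) =ᶠ[𝓝 y]
      fun z ↦ ContinuousLinearMap.compL ℝ E X Y L (fderiv ℝ u z) := by
    filter_upwards [hu.eventually (by simp)] with z hz
    rw [fderiv_comp z L.differentiableAt (hz.differentiableAt (by simp))]
    simp
  have h2 : DifferentiableAt ℝ (fderiv ℝ u) y :=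
    (hu.fderiv_right (m := 1) (by norm_num)).differentiableAt (by simp)
  erw [h1.fderiv_eq,
    HasFDerivAt.fderiv ((ContinuousLinearMap.compL ℝ E X Y L).hasFDerivAt.comp y h2.hasFDerivAt)]
  simp

theorem fderiv_fderiv_sq {u : E → ℂ} {y : E} (hu : ContDiffAt ℝ 2 u y) (hy : u y = 0) (v w : E) :
    fderiv ℝ (u * u) y = 0 ∧
    fderiv ℝ (fderiv ℝ (u * u)) y v w = 2 * (fderiv ℝ u y v * fderiv ℝ u y w) := by
  have h1 : fderiv ℝ (u * u) =ᶠ[𝓝 y] fun z ↦ u z • fderiv ℝ u z + u z • fderiv ℝ u z := by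
    filter_upwards [hu.eventually (by simp)] with z hz
    have := hz.differentiableAt (by simp)
    rw [fderiv_mul this this]
  refine ⟨by rw [h1.eq_of_nhds]; ext; simp [hy], ?_⟩
  have h2 : DifferentiableAt ℝ (fderiv ℝ u) y :=
    (hu.fderiv_right (m := 1) (by norm_num)).differentiableAt (by simp)
  have h3 := (hu.differentiableAt (by simp)).hasFDerivAt.smul h2.hasFDerivAt
  have h4 := (h3.add h3).congr_of_eventuallyEq h1
  rw [h4.fderiv, hy]
  simp
  ring

end Calculus

section Trace

variable {E : Type*} [NormedAddCommGroup E] [NormedSpace ℝ E] [FiniteDimensional ℝ E]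
  {M : Type*} [TopologicalSpace M] [ChartedSpace E M] [IsManifold 𝓘(ℝ, E) ∞ M]

theorem inner_dualFrame_frame (g : Metric E M) (x : M) (i j : Fin (Module.finrank ℝ E)) :
    g.inner x (dualFrame g x i) (frame x j) = if j = i then 1 else 0 :=
  LinearMap.BilinForm.apply_dualBasis_left (metricForm_nondegenerate g x) (frame x) i j

theorem sum_inner_frame_smul_dualFrame (g : Metric E M) (x : M) (v : TangentSpace 𝓘(ℝ, E) x) :
    ∑ i, g.inner x v (frame x i) • dualFrame g x i = v := by
  conv_rhs => rw [← (dualFrame g x).sum_repr v]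
  refine Finset.sum_congr rfl fun i _ ↦ ?_
  exact congrArg (· • _)
    (LinearMap.BilinForm.dualBasis_repr_apply (metricForm_nondegenerate g x) (frame x) v i).symm

theorem dualFrame_eq_sum (g : Metric E M) (x : M) (i : Fin (Module.finrank ℝ E)) :
    dualFrame g x i = ∑ j, g.inner x (dualFrame g x i) (dualFrame g x j) • frame x j := by
  conv_lhs => rw [← (frame x).sum_repr (dualFrame g x i)]
  refine Finset.sum_congr rfl fun j _ ↦ ?_
  congr 1
  rw [g.symm]
  conv_rhs => rw [← (frame x).sum_repr (dualFrame g x i)]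
  simp only [map_sum, map_smul, inner_dualFrame_frame, smul_eq_mul, mul_ite, mul_one, mul_zero,
    Finset.sum_ite_eq', Finset.mem_univ, if_true]

theorem trace_flip (g : Metric E M) (x : M) {X : Type*} [AddCommGroup X] [Module ℝ X]
    (B : TangentSpace 𝓘(ℝ, E) x →ₗ[ℝ] TangentSpace 𝓘(ℝ, E) x →ₗ[ℝ] X) :
    trace g x (fun u v ↦ B v u) = trace g x (fun u v ↦ B u v) := by
  unfold trace
  have h1 : ∀ i, B (dualFrame g x i) (frame x i) =
      ∑ j, g.inner x (dualFrame g x i) (dualFrame g x j) • B (frame x j) (frame x i) := fun i ↦ by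
    conv_lhs => rw [dualFrame_eq_sum g x i]
    simp
  have h2 : ∀ i, B (frame x i) (dualFrame g x i) =
      ∑ j, g.inner x (dualFrame g x i) (dualFrame g x j) • B (frame x i) (frame x j) := fun i ↦ by
    conv_lhs => rw [dualFrame_eq_sum g x i]
    simp
  simp_rw [h1, h2]
  rw [Finset.sum_comm]
  simp_rw [g.symm x (dualFrame g x _) (dualFrame g x _)]

end Trace

section Coordinates

variable {E : Type*} [NormedAddCommGroup E] [NormedSpace ℝ E]
  {M : Type*} [TopologicalSpace M] [ChartedSpace E M]
  {E' : Type*} [NormedAddCommGroup E'] [NormedSpace ℝ E']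
  {N : Type*} [TopologicalSpace N] [ChartedSpace E' N]

theorem mfderiv_eq_fderiv_writtenInExtChartAt {f : M → N} {x : M}
    (hf : MDifferentiableAt 𝓘(ℝ, E) 𝓘(ℝ, E') f x) :
    mfderiv 𝓘(ℝ, E) 𝓘(ℝ, E') f x =
      fderiv ℝ (writtenInExtChartAt 𝓘(ℝ, E) 𝓘(ℝ, E') x f) (extChartAt 𝓘(ℝ, E) x x) := by
  rw [hf.mfderiv, modelWithCornersSelf_coe, Set.range_id, fderivWithin_univ]

theorem contDiffAt_writtenInExtChartAt {f : M → N} {x : M}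
    (hf : ContMDiffAt 𝓘(ℝ, E) 𝓘(ℝ, E') ∞ f x) :
    ContDiffAt ℝ ∞ (writtenInExtChartAt 𝓘(ℝ, E) 𝓘(ℝ, E') x f) (extChartAt 𝓘(ℝ, E) x x) := by
  have := (contMDiffAt_iff.1 hf).2
  rwa [modelWithCornersSelf_coe, Set.range_id, contDiffWithinAt_univ] at this

theorem differentiableAt_coordForm [IsManifold 𝓘(ℝ, E) ∞ M] (g : Metric E M) (x : M) (v w : E) :
    DifferentiableAt ℝ (coordForm g.inner x v w) (extChartAt 𝓘(ℝ, E) x x) := by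
  have hs : ∀ v : E, ContMDiffAt 𝓘(ℝ, E) 𝓘(ℝ, E).tangent 1 (fun y : E ↦
      (⟨(extChartAt 𝓘(ℝ, E) x).symm y,
        mfderiv 𝓘(ℝ, E) 𝓘(ℝ, E) (extChartAt 𝓘(ℝ, E) x).symm y v⟩ : TangentBundle 𝓘(ℝ, E) M))
      (extChartAt 𝓘(ℝ, E) x x) := fun v ↦ by
    have h0 : ContMDiff 𝓘(ℝ, E) 𝓘(ℝ, E).tangent 1
        (fun y : E ↦ (⟨y, v⟩ : TangentBundle 𝓘(ℝ, E) E)) :=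
      contMDiff_vectorSpace_iff_contDiff.2 contDiff_const
    have h1 := (contMDiffOn_extChartAt_symm (I := 𝓘(ℝ, E)) (n := ∞) x).contMDiffOn_tangentMapWithin
      (m := 1) (by norm_cast) (isOpen_extChartAt_target x).uniqueMDiffOn
    refine ((h1.comp (h0.contMDiffOn (s := (extChartAt 𝓘(ℝ, E) x).target)) ?_).contMDiffAt
      (extChartAt_target_mem_nhds x)).congr_of_eventuallyEq ?_
    · exact fun y hy ↦ hy
    filter_upwards [extChartAt_target_mem_nhds (I := 𝓘(ℝ, E)) x] with y hy
    simp only [Function.comp_apply, tangentMapWithin]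
    rw [mfderivWithin_of_isOpen (isOpen_extChartAt_target x) hy]
  have hg : ContMDiffAt 𝓘(ℝ, E) (𝓘(ℝ, E).prod 𝓘(ℝ, E →L[ℝ] E →L[ℝ] ℝ)) 1 (fun y : E ↦
      (TotalSpace.mk' (E →L[ℝ] E →L[ℝ] ℝ)
        (E := fun b : M ↦ TangentSpace 𝓘(ℝ, E) b →L[ℝ] TangentSpace 𝓘(ℝ, E) b →L[ℝ] ℝ)
        ((extChartAt 𝓘(ℝ, E) x).symm y) (g.inner ((extChartAt 𝓘(ℝ, E) x).symm y))))
      (extChartAt 𝓘(ℝ, E) x x) :=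
    (g.contMDiff.of_le (by norm_cast)).contMDiffAt.comp _
      (((contMDiffOn_extChartAt_symm (n := ∞) x).contMDiffAt
        (extChartAt_target_mem_nhds x)).of_le (by norm_cast))
  have : ContMDiffAt 𝓘(ℝ, E) (𝓘(ℝ, E).prod 𝓘(ℝ, ℝ)) 1 (fun y : E ↦
      (TotalSpace.mk' ℝ (E := Bundle.Trivial M ℝ) ((extChartAt 𝓘(ℝ, E) x).symm y)
        (coordForm g.inner x v w y))) (extChartAt 𝓘(ℝ, E) x x) :=
    ContMDiffAt.clm_bundle_apply₂ (F₁ := E) (F₂ := E) hg (hs v) (hs w)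
  rw [contMDiffAt_totalSpace] at this
  exact (contMDiffAt_iff_contDiffAt.1 this.2).differentiableAt (by simp)

end Coordinates

section SecondOrder

variable {E : Type*} [NormedAddCommGroup E] [NormedSpace ℝ E]
  {X Y : Type*} [NormedAddCommGroup X] [NormedSpace ℝ X] [NormedAddCommGroup Y] [NormedSpace ℝ Y]
  {ι : Type*} [Fintype ι]

/-- The second-order differential operator `u ↦ ∑ i, (D²u (a i, b i) - Du (c i)) + Du v`. -/
noncomputable def secondOrderOp (a b c : ι → E) (v : E) (u : E → X) (y : E) : X :=
  ∑ i, (fderiv ℝ (fderiv ℝ u) y (a i) (b i) - fderiv ℝ u y (c i)) + fderiv ℝ u y v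

theorem secondOrderOp_clm_comp (a b c : ι → E) (v : E) {u : E → X} {y : E}
    (hu : ContDiffAt ℝ 2 u y) (L : X →L[ℝ] Y) :
    secondOrderOp a b c v (L ∘ u) y = L (secondOrderOp a b c v u y) := by
  have h : fderiv ℝ (L ∘ u) y = L.comp (fderiv ℝ u y) := by
    rw [fderiv_comp _ L.differentiableAt (hu.differentiableAt (by simp))]
    simp
  simp [secondOrderOp, fderiv_fderiv_clm_comp hu L, h]

theorem secondOrderOp_sq (a b c : ι → E) (v : E) {u : E → ℂ} {y : E}
    (hu : ContDiffAt ℝ 2 u y) (hy : u y = 0) :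
    secondOrderOp a b c v (u * u) y = 2 * ∑ i, fderiv ℝ u y (a i) * fderiv ℝ u y (b i) := by
  simp [secondOrderOp, fun v w ↦ (fderiv_fderiv_sq hu hy v w).2, (fderiv_fderiv_sq hu hy v v).1,
    Finset.mul_sum]

end SecondOrder

section Flat

variable {E : Type*} [NormedAddCommGroup E] [NormedSpace ℝ E] [FiniteDimensional ℝ E]
  {M : Type*} [TopologicalSpace M] [ChartedSpace E M] [IsManifold 𝓘(ℝ, E) ∞ M]

/-- The coordinate expression of `u ↦ τ_V(u)` on vector-valued functions `u`. -/
noncomputable def vLaplacian {X : Type*} [NormedAddCommGroup X] [NormedSpace ℝ X]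
    (g : Metric E M) (V : ∀ x : M, TangentSpace 𝓘(ℝ, E) x) (x : M)
    (u : E → X) : X :=
  secondOrderOp (E := E) (fun i ↦ frame x i) (fun i ↦ dualFrame g x i)
    (fun i ↦ christoffel g x (frame x i) (dualFrame g x i)) (V x) u (extChartAt 𝓘(ℝ, E) x x)

variable {X : Type*} [NormedAddCommGroup X] [InnerProductSpace ℝ X] [FiniteDimensional ℝ X]
  {Y : Type*} [NormedAddCommGroup Y] [InnerProductSpace ℝ Y] [FiniteDimensional ℝ Y]

theorem christoffel_flatMetric (x : X) (u v : TangentSpace 𝓘(ℝ, X) x) :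
    christoffel (flatMetric X) x u v = 0 := by
  have h : ∀ u v w : TangentSpace 𝓘(ℝ, X) x,
      coordFormDeriv (flatMetric X).inner x u v w = 0 := fun u v w ↦ by
    have : coordForm (flatMetric X).inner x v w = fun _ ↦ inner ℝ (E := X) v w := by
      ext y
      have hm : mfderiv 𝓘(ℝ, X) 𝓘(ℝ, X) (extChartAt 𝓘(ℝ, X) x).symm y =
          ContinuousLinearMap.id ℝ (TangentSpace 𝓘(ℝ, X) y) := mfderiv_id
      unfold coordForm
      rw [hm]
      rfl
    rw [coordFormDeriv, this, fderiv_fun_const]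
    rfl
  simp [christoffel, h]

theorem vTension_flatMetric (g : Metric E M) (V : ∀ x : M, TangentSpace 𝓘(ℝ, E) x) {u : M → X}
    {x : M} (hu : ContMDiffAt 𝓘(ℝ, E) 𝓘(ℝ, X) ∞ u x) :
    vTension g (flatMetric X) V u x = vLaplacian g V x (u ∘ (extChartAt 𝓘(ℝ, E) x).symm) := by
  have hm : mfderiv 𝓘(ℝ, E) 𝓘(ℝ, X) u x =
      fderiv ℝ (u ∘ (extChartAt 𝓘(ℝ, E) x).symm) (extChartAt 𝓘(ℝ, E) x x) :=
    mfderiv_eq_fderiv_writtenInExtChartAt (hu.mdifferentiableAt (by simp))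
  simp only [vTension, tension, trace, secondFundamentalForm, christoffel_flatMetric, add_zero]
  rw [hm]
  rfl

theorem tension_eq_vTension (g : Metric E M) (u : M → X) (x : M) :
    tension g (flatMetric X) u x = vTension g (flatMetric X) (fun _ ↦ 0) u x := by
  simp [vTension]

theorem vTension_clm_comp (g : Metric E M) (V : ∀ x : M, TangentSpace 𝓘(ℝ, E) x) {u : M → X}
    {x : M} (hu : ContMDiffAt 𝓘(ℝ, E) 𝓘(ℝ, X) ∞ u x) (L : X →L[ℝ] Y) :
    vTension g (flatMetric Y) V (L ∘ u) x = (L (vTension g (flatMetric X) V u x : X) : Y) := by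
  have hu' : ContDiffAt ℝ ∞ (u ∘ (extChartAt 𝓘(ℝ, E) x).symm) (extChartAt 𝓘(ℝ, E) x x) :=
    contDiffAt_writtenInExtChartAt hu
  rw [vTension_flatMetric g V (L.contMDiff.contMDiffAt.comp x hu), vTension_flatMetric g V hu,
    Function.comp_assoc]
  exact secondOrderOp_clm_comp _ _ _ _ (hu'.of_le (by norm_cast)) L

/-- `V`-harmonic morphisms pull back local harmonic maps to `ℂ` to local `V`-harmonic maps. -/
theorem IsVHarmonicMorphism.comp_complex
    {E' : Type*} [NormedAddCommGroup E'] [NormedSpace ℝ E'] [FiniteDimensional ℝ E']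
    {N : Type*} [TopologicalSpace N] [ChartedSpace E' N] [IsManifold 𝓘(ℝ, E') ∞ N]
    {g : Metric E M} {h : Metric E' N} {V : ∀ x : M, TangentSpace 𝓘(ℝ, E) x} {ψ : M → N}
    (hψ : IsVHarmonicMorphism g h V ψ) {U : Set N} (hU : IsOpen U) {f : N → ℂ}
    (hf : IsHarmonicOn h (flatMetric ℂ) f U) :
    IsVHarmonicOn g (flatMetric ℂ) V (f ∘ ψ) (ψ ⁻¹' U) := by
  have hc : ContMDiffOn 𝓘(ℝ, E) 𝓘(ℝ, ℂ) ∞ (f ∘ ψ) (ψ ⁻¹' U) :=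
    hf.1.comp hψ.1.contMDiffOn fun x hx ↦ hx
  have key : ∀ (L : ℂ →L[ℝ] ℝ), ∀ x ∈ ψ ⁻¹' U,
      L (vTension g (flatMetric ℂ) V (f ∘ ψ) x : ℂ) = 0 := fun L x hx ↦ by
    have hL : IsHarmonicOn h (flatMetric ℝ) (L ∘ f) U := by
      refine ⟨L.contMDiff.comp_contMDiffOn hf.1, fun y hy ↦ ?_⟩
      rw [tension_eq_vTension, vTension_clm_comp h _ (hf.1.contMDiffAt (hU.mem_nhds hy)) L,
        ← tension_eq_vTension, hf.2 y hy]
      exact map_zero L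
    have := (hψ.2 U _ hU hL).2 x hx
    rwa [Function.comp_assoc, vTension_clm_comp g V
      (hc.contMDiffAt ((hU.preimage hψ.1.continuous).mem_nhds hx)) L] at this
  exact ⟨hc, fun x hx ↦ Complex.ext (key Complex.reCLM x hx) (key Complex.imCLM x hx)⟩

end Flat

section LeviCivita

variable {E : Type*} [NormedAddCommGroup E] [NormedSpace ℝ E]
  {M : Type*} [TopologicalSpace M] [ChartedSpace E M] [IsManifold 𝓘(ℝ, E) ∞ M]

theorem coordFormDeriv_symm (g : Metric E M) (x : M) (u v w : TangentSpace 𝓘(ℝ, E) x) :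
    coordFormDeriv g.inner x u v w = coordFormDeriv g.inner x u w v := by
  have : coordForm g.inner x v w = coordForm g.inner x w v := funext fun y ↦ g.symm _ _ _
  rw [coordFormDeriv, this, coordFormDeriv]

theorem coordFormDeriv_add_mid (g : Metric E M) (x : M) (u v v' w : TangentSpace 𝓘(ℝ, E) x) :
    coordFormDeriv g.inner x u (v + v') w =
      coordFormDeriv g.inner x u v w + coordFormDeriv g.inner x u v' w := by
  have : coordForm g.inner x (v + v') w = coordForm g.inner x v w + coordForm g.inner x v' w := by
    ext y
    unfold coordForm
    erw [map_add, map_add]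
    rfl
  unfold coordFormDeriv
  erw [this, fderiv_add (differentiableAt_coordForm g x v w) (differentiableAt_coordForm g x v' w)]
  rfl

theorem coordFormDeriv_smul_mid (g : Metric E M) (x : M) (r : ℝ)
    (u v w : TangentSpace 𝓘(ℝ, E) x) :
    coordFormDeriv g.inner x u (r • v) w = r * coordFormDeriv g.inner x u v w := by
  have : coordForm g.inner x (r • v) w = r • coordForm g.inner x v w := by
    ext y
    unfold coordForm
    erw [map_smul, map_smul]
    rfl
  unfold coordFormDeriv
  erw [this, fderiv_const_smul (differentiableAt_coordForm g x v w)]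
  rfl

/-- The trilinear form `(v, w, u) ↦ u^k v^i w^j ∂_k g_ij`. -/
noncomputable def metricDeriv (g : Metric E M) (x : M) :
    TangentSpace 𝓘(ℝ, E) x →ₗ[ℝ] TangentSpace 𝓘(ℝ, E) x →ₗ[ℝ] TangentSpace 𝓘(ℝ, E) x →ₗ[ℝ] ℝ :=
  LinearMap.mk₂ ℝ
    (fun v w ↦
      (fderiv ℝ (coordForm g.inner x v w) (extChartAt 𝓘(ℝ, E) x x) : E →L[ℝ] ℝ).toLinearMap)
    (fun v v' w ↦ LinearMap.ext fun u ↦ coordFormDeriv_add_mid g x u v v' w)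
    (fun r v w ↦ LinearMap.ext fun u ↦ coordFormDeriv_smul_mid g x r u v w)
    (fun v w w' ↦ LinearMap.ext fun u ↦ by
      have := coordFormDeriv_add_mid g x u w w' v
      simp only [coordFormDeriv_symm g x u _ v] at this
      exact this)
    (fun r v w ↦ LinearMap.ext fun u ↦ by
      have := coordFormDeriv_smul_mid g x r u w v
      simp only [coordFormDeriv_symm g x u _ v] at this
      exact this)

theorem metricDeriv_apply (g : Metric E M) (x : M) (u v w : TangentSpace 𝓘(ℝ, E) x) :
    metricDeriv g x v w u = coordFormDeriv g.inner x u v w := rfl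

variable [FiniteDimensional ℝ E]

theorem inner_sum_smul_dualFrame (g : Metric E M) (x : M)
    (α : TangentSpace 𝓘(ℝ, E) x →ₗ[ℝ] ℝ) (w : TangentSpace 𝓘(ℝ, E) x) :
    g.inner x (∑ l, α (frame x l) • dualFrame g x l) w = α w := by
  conv_lhs => rw [← (frame x).sum_repr w]
  conv_rhs => rw [← (frame x).sum_repr w]
  simp only [map_sum, map_smul, sum_apply, smul_apply,
    inner_dualFrame_frame, smul_eq_mul, mul_ite, mul_one, mul_zero, Finset.sum_ite_eq,
    Finset.mem_univ, if_true]

theorem inner_christoffel (g : Metric E M) (x : M) (u v w : TangentSpace 𝓘(ℝ, E) x) :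
    g.inner x (christoffel g x u v) w =
      (1 / 2 : ℝ) * (coordFormDeriv g.inner x u v w + coordFormDeriv g.inner x v u w
        - coordFormDeriv g.inner x w u v) := by
  have h := inner_sum_smul_dualFrame g x ((1 / 2 : ℝ) •
    ((metricDeriv g x v).flip u + (metricDeriv g x u).flip v - metricDeriv g x u v)) w
  exact h

theorem eq_of_forall_inner_eq (g : Metric E M) (x : M) {a b : TangentSpace 𝓘(ℝ, E) x}
    (h : ∀ w, g.inner x a w = g.inner x b w) : a = b := by
  rw [← sum_inner_frame_smul_dualFrame g x a, ← sum_inner_frame_smul_dualFrame g x b]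
  simp_rw [h]

theorem christoffel_symm (g : Metric E M) (x : M) (u v : TangentSpace 𝓘(ℝ, E) x) :
    christoffel g x u v = christoffel g x v u :=
  eq_of_forall_inner_eq g x fun w ↦ by
    rw [inner_christoffel, inner_christoffel, coordFormDeriv_symm g x w u v]
    ring

theorem christoffel_add_left (g : Metric E M) (x : M) (u u' v : TangentSpace 𝓘(ℝ, E) x) :
    christoffel g x (u + u') v = christoffel g x u v + christoffel g x u' v :=
  eq_of_forall_inner_eq g x fun w ↦ by
    simp only [inner_christoffel, ← metricDeriv_apply, map_add, add_apply,
      LinearMap.add_apply]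
    ring

theorem christoffel_smul_left (g : Metric E M) (x : M) (r : ℝ) (u v : TangentSpace 𝓘(ℝ, E) x) :
    christoffel g x (r • u) v = r • christoffel g x u v :=
  eq_of_forall_inner_eq g x fun w ↦ by
    simp only [inner_christoffel, ← metricDeriv_apply, map_smul, smul_apply,
      LinearMap.smul_apply, smul_eq_mul]
    ring

end LeviCivita

section Kahler

variable {F : Type*} [NormedAddCommGroup F] [NormedSpace ℂ F]
  {P : Type*} [TopologicalSpace P] [ChartedSpace F P]

theorem J_J (p : P) (v : TangentSpace 𝓘(ℝ, F) p) : J p (J p v) = -v := by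
  have h (z : F) : Complex.I • Complex.I • z = -z := by
    rw [smul_smul, Complex.I_mul_I, neg_one_smul]
  exact h v

variable [IsManifold 𝓘(ℂ, F) ω P]

theorem mfderiv_extChartAt_symm_J (p : P) {y : F} (hy : y ∈ (extChartAt 𝓘(ℝ, F) p).target)
    (v : F) :
    mfderiv 𝓘(ℝ, F) 𝓘(ℝ, F) (extChartAt 𝓘(ℝ, F) p).symm y (Complex.I • v) =
      J _ (mfderiv 𝓘(ℝ, F) 𝓘(ℝ, F) (extChartAt 𝓘(ℝ, F) p).symm y v) := by
  have h1 : MDifferentiableAt 𝓘(ℂ, F) 𝓘(ℂ, F) (extChartAt 𝓘(ℂ, F) p).symm y :=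
    ((contMDiffOn_extChartAt_symm (I := 𝓘(ℂ, F)) (n := ω) p).contMDiffAt
      ((isOpen_extChartAt_target p).mem_nhds hy)).mdifferentiableAt (by simp)
  have h2 : HasMFDerivAt 𝓘(ℝ, F) 𝓘(ℝ, F) (extChartAt 𝓘(ℝ, F) p).symm y
      ((mfderiv 𝓘(ℂ, F) 𝓘(ℂ, F) (extChartAt 𝓘(ℂ, F) p).symm y : F →L[ℂ] F).restrictScalars ℝ) :=
    ⟨h1.hasMFDerivAt.1, h1.hasMFDerivAt.2.restrictScalars ℝ⟩
  rw [h2.mfderiv]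
  exact map_smul (mfderiv 𝓘(ℂ, F) 𝓘(ℂ, F) (extChartAt 𝓘(ℂ, F) p).symm y : F →L[ℂ] F) Complex.I v

theorem IsKahler.inner_J_left {k : Metric F P} (hk : IsKahler k) (p : P)
    (v w : TangentSpace 𝓘(ℝ, F) p) : k.inner p (J p v) w = -k.inner p v (J p w) := by
  rw [← hk.hermitian p v (J p w), J_J, map_neg, neg_neg]

theorem IsKahler.coordFormDeriv_J_J {k : Metric F P} (hk : IsKahler k) (p : P)
    (u v w : TangentSpace 𝓘(ℝ, F) p) :
    coordFormDeriv k.inner p u (J p v) (J p w) = coordFormDeriv k.inner p u v w := by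
  have : coordForm k.inner p (J p v) (J p w) =ᶠ[𝓝 (extChartAt 𝓘(ℝ, F) p p)]
      coordForm k.inner p v w := by
    filter_upwards [extChartAt_target_mem_nhds (I := 𝓘(ℝ, F)) p] with y hy
    have h := hk.hermitian _ (mfderiv 𝓘(ℝ, F) 𝓘(ℝ, F) (extChartAt 𝓘(ℝ, F) p).symm y v)
      (mfderiv 𝓘(ℝ, F) 𝓘(ℝ, F) (extChartAt 𝓘(ℝ, F) p).symm y w)
    rw [← mfderiv_extChartAt_symm_J p hy v, ← mfderiv_extChartAt_symm_J p hy w] at h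
    exact h
  rw [coordFormDeriv, this.fderiv_eq, coordFormDeriv]

theorem coordFormDeriv_fundamentalForm (k : Metric F P) (p : P)
    (u v w : TangentSpace 𝓘(ℝ, F) p) :
    coordFormDeriv (fundamentalForm k) p u v w = coordFormDeriv k.inner p u (J p v) w := by
  have : coordForm (fundamentalForm k) p v w =ᶠ[𝓝 (extChartAt 𝓘(ℝ, F) p p)]
      coordForm k.inner p (J p v) w := by
    filter_upwards [extChartAt_target_mem_nhds (I := 𝓘(ℝ, F)) p] with y hy
    have h := mfderiv_extChartAt_symm_J p hy v
    change k.inner _ (J _ (mfderiv 𝓘(ℝ, F) 𝓘(ℝ, F) (extChartAt 𝓘(ℝ, F) p).symm y v)) _ = _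
    rw [← h]
    rfl
  rw [coordFormDeriv, this.fderiv_eq, coordFormDeriv]

variable [FiniteDimensional ℂ F]

/-- On a Kähler manifold, the Christoffel symbol in a holomorphic chart is complex linear. -/
theorem IsKahler.christoffel_J_left {k : Metric F P} (hk : IsKahler k) (p : P)
    (u v : TangentSpace 𝓘(ℝ, F) p) :
    christoffel k p (J p u) v = J p (christoffel k p u v) :=
  eq_of_forall_inner_eq k p fun w ↦ by
    have neg_mid : ∀ a b c, coordFormDeriv k.inner p a (-b) c = -coordFormDeriv k.inner p a b c :=
      fun a b c ↦ by simp [← metricDeriv_apply]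
    have J_mid : ∀ a b c, coordFormDeriv k.inner p a (J p b) c =
        -coordFormDeriv k.inner p a b (J p c) := fun a b c ↦ by
      rw [← hk.coordFormDeriv_J_J p a b (J p c), J_J, coordFormDeriv_symm k p a _ (-c), neg_mid,
        neg_neg, coordFormDeriv_symm]
    have c1 := hk.closed p u v w
    have c2 := hk.closed p (J p u) v (J p w)
    simp only [coordFormDeriv_fundamentalForm, J_J, neg_mid, hk.coordFormDeriv_J_J] at c1 c2
    rw [hk.inner_J_left, inner_christoffel, inner_christoffel]
    have e1 := J_mid v u w
    have e2 := J_mid u v w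
    have e3 := J_mid v w u
    have e4 := coordFormDeriv_symm k p v w (J p u)
    linarith

/-- The Christoffel symbol of a Kähler metric as a complex bilinear map. -/
theorem IsKahler.exists_christoffel_eq {k : Metric F P} (hk : IsKahler k) (p : P) :
    ∃ G : F →ₗ[ℂ] F →ₗ[ℂ] F, ∀ u v : F, G u v = christoffel k p u v := by
  let Γ : F → F → F := fun u v ↦ christoffel k p u v
  have hs : ∀ u v, Γ u v = Γ v u := christoffel_symm k p
  have ha : ∀ u u' v, Γ (u + u') v = Γ u v + Γ u' v := christoffel_add_left k p
  have hr : ∀ (r : ℝ) u v, Γ (r • u) v = r • Γ u v := christoffel_smul_left k p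
  have hI : ∀ u v, Γ (Complex.I • u) v = Complex.I • Γ u v := hk.christoffel_J_left p
  have hc : ∀ (c : ℂ) u v, Γ (c • u) v = c • Γ u v := fun c u v ↦ by
    have split : ∀ z : F, c • z = c.re • z + c.im • Complex.I • z := fun z ↦ by
      conv_lhs => rw [← Complex.re_add_im c]
      rw [add_smul, mul_smul, Complex.coe_smul, Complex.coe_smul]
    rw [split, split, ha, hr, hr, hI]
  exact ⟨LinearMap.mk₂ ℂ Γ ha hc (fun u v v' ↦ by rw [hs, ha, hs v, hs v'])
    (fun c u v ↦ by rw [hs, hc, hs v]), fun u v ↦ rfl⟩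

end Kahler

section Holomorphic

variable {E : Type*} [NormedAddCommGroup E] [NormedSpace ℝ E] [FiniteDimensional ℝ E]
  {M : Type*} [TopologicalSpace M] [ChartedSpace E M] [IsManifold 𝓘(ℝ, E) ∞ M]
  {F : Type*} [NormedAddCommGroup F] [NormedSpace ℂ F]
  {P : Type*} [TopologicalSpace P] [ChartedSpace F P] [IsManifold 𝓘(ℂ, F) ω P]

/-- If the holomorphic functions on the chart domain around `Φ x` are pulled back to `V`-harmonic
maps, then the coordinates of `Φ` are annihilated by `τ_V`, and the complex bilinear extension of
`g` to the dual vanishes on pairs of components of `dΦ`. -/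
theorem vLaplacian_eq_zero_and_sum_eq_zero {g : Metric E M} {V : ∀ x : M, TangentSpace 𝓘(ℝ, E) x}
    {Φ : M → P} (hΦ : ContMDiff 𝓘(ℝ, E) 𝓘(ℝ, F) ∞ Φ) (x : M)
    (H : ∀ f : P → ℂ, MDifferentiableOn 𝓘(ℂ, F) 𝓘(ℂ) f (chartAt F (Φ x)).source →
      IsVHarmonicOn g (flatMetric ℂ) V (f ∘ Φ) (Φ ⁻¹' (chartAt F (Φ x)).source)) :
    vLaplacian g V x (writtenInExtChartAt 𝓘(ℝ, E) 𝓘(ℝ, F) x Φ) = 0 ∧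
    ∀ ℓ m : F →L[ℂ] ℂ,
      ∑ i, ℓ (mfderiv 𝓘(ℝ, E) 𝓘(ℝ, F) Φ x (frame x i)) *
        m (mfderiv 𝓘(ℝ, E) 𝓘(ℝ, F) Φ x (dualFrame g x i)) = 0 := by
  set u : E → F := writtenInExtChartAt 𝓘(ℝ, E) 𝓘(ℝ, F) x Φ with hu
  set y := extChartAt 𝓘(ℝ, E) x x with hy
  have hsm : ContDiffAt ℝ 2 u y :=
    (contDiffAt_writtenInExtChartAt (hΦ x)).of_le (by norm_cast)
  have huy : u y = chartAt F (Φ x) (Φ x) := by simp [hu, hy, writtenInExtChartAt]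
  have hmf : mfderiv 𝓘(ℝ, E) 𝓘(ℝ, F) Φ x = fderiv ℝ u y :=
    mfderiv_eq_fderiv_writtenInExtChartAt ((hΦ x).mdifferentiableAt (by simp))
  have hchart : MDifferentiableOn 𝓘(ℂ, F) 𝓘(ℂ, F) (chartAt F (Φ x)) (chartAt F (Φ x)).source :=
    mdifferentiableOn_atlas (I := 𝓘(ℂ, F)) (chart_mem_atlas F (Φ x))
  have hpull : ∀ q : F → ℂ, Differentiable ℂ q → vLaplacian g V x (q ∘ u) = 0 := fun q hq ↦ by
    have h := H (q ∘ chartAt F (Φ x)) (hq.mdifferentiable.comp_mdifferentiableOn hchart)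
    have hx : x ∈ Φ ⁻¹' (chartAt F (Φ x)).source := mem_chart_source F (Φ x)
    have := h.2 x hx
    rwa [vTension_flatMetric g V (h.1.contMDiffAt
      (((chartAt F (Φ x)).open_source.preimage hΦ.continuous).mem_nhds hx))] at this
  constructor
  · refine eq_zero_of_forall_clm fun ℓ ↦ ?_
    rw [← hpull ℓ ℓ.differentiable]
    exact (secondOrderOp_clm_comp _ _ _ _ hsm (ℓ.restrictScalars ℝ)).symm
  have hsq : ∀ ℓ : F →L[ℂ] ℂ, ∑ i, ℓ (fderiv ℝ u y (frame x i)) *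
      ℓ (fderiv ℝ u y (dualFrame g x i)) = 0 := fun ℓ ↦ by
    let a : E → ℂ := fun z ↦ ℓ (u z) - ℓ (u y)
    have ha : ContDiffAt ℝ 2 a y :=
      ((ℓ.restrictScalars ℝ).contDiff.contDiffAt.comp y hsm).sub contDiffAt_const
    have had : ∀ v : E, fderiv ℝ a y v = ℓ (fderiv ℝ u y v) := fun v ↦ by
      have h := ((ℓ.restrictScalars ℝ).hasFDerivAt.comp y
        (hsm.differentiableAt (by simp)).hasFDerivAt).sub_const (ℓ (u y))
      exact congrArg (· v) h.fderiv
    have h := hpull (fun z ↦ (ℓ z - ℓ (u y)) * (ℓ z - ℓ (u y))) (by fun_prop)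
    have h' := secondOrderOp_sq (E := E) (fun i ↦ frame x i) (fun i ↦ dualFrame g x i)
      (fun i ↦ christoffel g x (frame x i) (dualFrame g x i)) (V x) ha (sub_self _)
    have h'' : 2 * ∑ i, fderiv ℝ a y (frame x i) * fderiv ℝ a y (dualFrame g x i) = 0 :=
      h'.symm.trans h
    exact (Finset.sum_congr rfl fun i _ ↦ congrArg₂ (· * ·) (had _).symm (had _).symm).trans
      ((mul_eq_zero.1 h'').resolve_left two_ne_zero)
  intro ℓ m
  rw [hmf]
  let B : (F →L[ℂ] ℂ) → (F →L[ℂ] ℂ) → E →ₗ[ℝ] E →ₗ[ℝ] ℂ := fun ℓ m ↦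
    (LinearMap.mul ℝ ℂ).compl₁₂ ((ℓ.restrictScalars ℝ).comp (fderiv ℝ u y)).toLinearMap
      ((m.restrictScalars ℝ).comp (fderiv ℝ u y)).toLinearMap
  have hflip : ∑ i, m (fderiv ℝ u y (frame x i)) * ℓ (fderiv ℝ u y (dualFrame g x i)) =
      ∑ i, ℓ (fderiv ℝ u y (frame x i)) * m (fderiv ℝ u y (dualFrame g x i)) := by
    have h : _ = ∑ i, ℓ (fderiv ℝ u y (frame x i)) * m (fderiv ℝ u y (dualFrame g x i)) :=
      trace_flip g x (B ℓ m)
    rw [← h]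
    exact Finset.sum_congr rfl fun i _ ↦ mul_comm _ _
  have h := hsq (ℓ + m)
  simp only [add_apply, add_mul, mul_add, Finset.sum_add_distrib, hsq, hflip] at h
  linear_combination h / 2

theorem mfderiv_diffAdjoint {E' : Type*} [NormedAddCommGroup E'] [NormedSpace ℝ E']
    [FiniteDimensional ℝ E'] {N : Type*} [TopologicalSpace N] [ChartedSpace E' N]
    [IsManifold 𝓘(ℝ, E') ∞ N] (g : Metric E M) (h : Metric E' N) (φ : M → N) (x : M)
    (w : TangentSpace 𝓘(ℝ, E') (φ x)) :
    mfderiv 𝓘(ℝ, E) 𝓘(ℝ, E') φ x (diffAdjoint g h φ x w) =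
      ∑ i, h.inner (φ x) w (mfderiv 𝓘(ℝ, E) 𝓘(ℝ, E') φ x (frame x i)) •
        mfderiv 𝓘(ℝ, E) 𝓘(ℝ, E') φ x (dualFrame g x i) := by
  have key : ∀ v, g.inner x (diffAdjoint g h φ x w) v =
      h.inner (φ x) w (mfderiv 𝓘(ℝ, E) 𝓘(ℝ, E') φ x v) := fun v ↦
    LinearMap.BilinForm.apply_toDual_symm_apply (hB := metricForm_nondegenerate g x) _ v
  conv_lhs => rw [← sum_inner_frame_smul_dualFrame g x (diffAdjoint g h φ x w)]
  simp only [map_sum, map_smul, key]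

variable [FiniteDimensional ℂ F]

/-- A smooth map to a Kähler manifold that pulls back local holomorphic functions to local
`V`-harmonic maps is a `V`-pseudo harmonic morphism. -/
theorem isVPseudoHarmonicMorphism_of_pullback {g : Metric E M} {k : Metric F P} (hk : IsKahler k)
    {V : ∀ x : M, TangentSpace 𝓘(ℝ, E) x} {Φ : M → P} (hΦ : ContMDiff 𝓘(ℝ, E) 𝓘(ℝ, F) ∞ Φ)
    (H : ∀ (W : Set P) (f : P → ℂ), IsOpen W → MDifferentiableOn 𝓘(ℂ, F) 𝓘(ℂ) f W →
      IsVHarmonicOn g (flatMetric ℂ) V (f ∘ Φ) (Φ ⁻¹' W)) :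
    IsVPseudoHarmonicMorphism g k V Φ := by
  have hx := fun x ↦ vLaplacian_eq_zero_and_sum_eq_zero hΦ x
    fun f hf ↦ H _ f (chartAt F (Φ x)).open_source hf
  refine ⟨⟨hΦ, fun x ↦ ?_⟩, fun x w ↦ ?_⟩
  · obtain ⟨h1, h2⟩ := hx x
    obtain ⟨G, hG⟩ := hk.exists_christoffel_eq (Φ x)
    have h3 := sum_bilinear_eq_zero h2 G
    have hmf : mfderiv 𝓘(ℝ, E) 𝓘(ℝ, F) Φ x =
        fderiv ℝ (writtenInExtChartAt 𝓘(ℝ, E) 𝓘(ℝ, F) x Φ) (extChartAt 𝓘(ℝ, E) x x) :=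
      mfderiv_eq_fderiv_writtenInExtChartAt ((hΦ x).mdifferentiableAt (by simp))
    let S : F := ∑ i, christoffel k (Φ x) (mfderiv 𝓘(ℝ, E) 𝓘(ℝ, F) Φ x (frame x i))
      (mfderiv 𝓘(ℝ, E) 𝓘(ℝ, F) Φ x (dualFrame g x i))
    have hS : S = 0 := (Finset.sum_congr rfl fun i _ ↦ (hG _ _).symm).trans h3
    have h4 : vTension g k V Φ x =
        (vLaplacian g V x (writtenInExtChartAt 𝓘(ℝ, E) 𝓘(ℝ, F) x Φ) + S : F) := by
      simp only [vTension, tension, trace, secondFundamentalForm, Finset.sum_add_distrib]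
      rw [add_right_comm]
      simp only [S, hmf]
      rfl
    rw [h4, h1, hS, zero_add]
    rfl
  · rw [mfderiv_diffAdjoint, mfderiv_diffAdjoint]
    exact sum_smul_I_eq (hx x).2 (α := k.inner (Φ x) w) (β := k.inner (Φ x) (J (Φ x) w))
      (hk.inner_J_left (Φ x) w)

end Holomorphic

theorem IsVHarmonicMorphism.comp_isPseudoHarmonicMorphism
    {E : Type*} [NormedAddCommGroup E] [NormedSpace ℝ E] [FiniteDimensional ℝ E]
    {M : Type*} [TopologicalSpace M] [ChartedSpace E M] [IsManifold 𝓘(ℝ, E) ∞ M]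
    {E' : Type*} [NormedAddCommGroup E'] [NormedSpace ℝ E'] [FiniteDimensional ℝ E']
    {N : Type*} [TopologicalSpace N] [ChartedSpace E' N] [IsManifold 𝓘(ℝ, E') ∞ N]
    {F : Type*} [NormedAddCommGroup F] [NormedSpace ℂ F] [FiniteDimensional ℂ F]
    {P : Type*} [TopologicalSpace P] [ChartedSpace F P] [IsManifold 𝓘(ℂ, F) ω P]
    {g : Metric E M} {h : Metric E' N} {k : Metric F P} (hk : IsKahler k)
    {V : ∀ x : M, TangentSpace 𝓘(ℝ, E) x} {ψ : M → N} {φ : N → P}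
    (hψ : IsVHarmonicMorphism g h V ψ) (hφ : IsPseudoHarmonicMorphism F h φ) :
    IsVPseudoHarmonicMorphism g k V (φ ∘ ψ) :=
  isVPseudoHarmonicMorphism_of_pullback hk (hφ.1.comp hψ.1) fun W f hW hf ↦
    hψ.comp_complex (hW.preimage hφ.1.continuous) (hφ.2 W f hW hf)

end VHarm

theorem proposition3p3
    {E : Type*} [NormedAddCommGroup E] [NormedSpace ℝ E] [FiniteDimensional ℝ E]
    {M : Type*} [TopologicalSpace M] [ChartedSpace E M] [IsManifold 𝓘(ℝ, E) ∞ M]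
    {E' : Type*} [NormedAddCommGroup E'] [NormedSpace ℝ E'] [FiniteDimensional ℝ E']
    {N : Type*} [TopologicalSpace N] [ChartedSpace E' N] [IsManifold 𝓘(ℝ, E') ∞ N]
    {F : Type*} [NormedAddCommGroup F] [NormedSpace ℂ F] [FiniteDimensional ℂ F]
    {P : Type*} [TopologicalSpace P] [ChartedSpace F P] [IsManifold 𝓘(ℂ, F) ω P]
    (g : VHarm.Metric E M) (h : VHarm.Metric E' N) (k : VHarm.Metric F P)
    (hk : VHarm.IsKahler k)
    (V : ∀ x : M, TangentSpace 𝓘(ℝ, E) x) (hV : VHarm.IsSmoothVectorField V)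
    (ψ : M → N) (φ : N → P)
    (hψ : VHarm.IsVHarmonicMorphism g h V ψ)
    (hφ : VHarm.IsPseudoHarmonicMorphism F h φ) :
    VHarm.IsVPseudoHarmonicMorphism g k V (φ ∘ ψ) :=
  hψ.comp_isPseudoHarmonicMorphism hk hφ
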